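/- For a real number $x>1$ let $\mathbf S_x=\{\lfloor x^n\rfloor : n\in\mathbb N\}$. A set $A$ of positive integers is a Sidon set if, for all $a,b,c,d\in A$ (not necessarily distinct), $a+b=c+d$ implies $\{a,b\}=\{c,d\}$. Call $\mathbf S_x$ tail Sidon if there is an $N_0$ such that $\{\lfloor x^n\rfloor : n\ge N_0\}$ is a Sidon set. Then for every $\varepsilon>0$ there exists $r\in(2-\varepsilon,2)$ for which $\mathbf S_r$ is not tail Sidon. -/

import Mathlib

/-- A set of integers is a Sidon set if `a + b = c + d` has only the trivial solutions in it,
that is, those with `{a, b} = {c, d}` as unordered pairs (equal summands are allowed). -/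
def IsSidonSet (A : Set ℤ) : Prop :=
  ∀ a ∈ A, ∀ b ∈ A, ∀ c ∈ A, ∀ d ∈ A,
    a + b = c + d → (a = c ∧ b = d) ∨ (a = d ∧ b = c)

/-- The tail `{⌊x ^ n⌋ : n ≥ N}` of the set `S_x = {⌊x ^ n⌋ : n ∈ ℕ}`. -/
def floorPowTail (x : ℝ) (N : ℕ) : Set ℤ :=
  {m : ℤ | ∃ n : ℕ, N ≤ n ∧ m = ⌊x ^ n⌋}

/-- `S_x` is tail Sidon if one of its tails is a Sidon set. -/
def IsTailSidon (x : ℝ) : Prop :=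
  ∃ N₀ : ℕ, IsSidonSet (floorPowTail x N₀)

open Filter Topology
open scoped ComplexOrder

/-! For odd `m`, let `r` be the positive root of `x^m = 1 + x + ... + x^(m-1)`; it tends to 2 as `m`
grows. It is a Pisot number, so the integer power sums `T n` of all the roots satisfy `r^n - T n →
0`, and `T (n+m+1) + T n = 2 * T (n+m)`. If the errors at `n`, `n+m`, `n+m+1` share a sign, the
floors differ from `T` by the same constant and satisfy the same relation, a nontrivial Sidon
violation. Such `n` occur arbitrarily late. -/

theorem exists_same_sign_of_recurrence {d : ℕ → ℝ} {m : ℕ} (hm : Odd m)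
    (hd : Tendsto d atTop (𝓝 0)) (hrec : ∀ n, d (n + m + 1) + d n = 2 * d (n + m)) (N : ℕ) :
    ∃ n, N ≤ n ∧ (0 ≤ d n ↔ 0 ≤ d (n + m)) ∧ (0 ≤ d n ↔ 0 ≤ d (n + m + 1)) := by
  by_contra! hcon
  -- By the recurrence, equal signs at `n` and `n+m+1` would force that sign at `n+m` too.
  have anti : ∀ n, N ≤ n → (0 ≤ d (n + m + 1) ↔ ¬ 0 ≤ d n) := by
    intro n hn
    have h1 := hcon n hn
    have h2 := hrec n
    by_cases ha : 0 ≤ d n <;> by_cases hb : 0 ≤ d (n + m) <;>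
      by_cases hc : 0 ≤ d (n + m + 1) <;> simp [ha, hb, hc] at h1 ⊢ <;>
      first | linarith | (rcases h1 with h1 | h1 <;> linarith)
  -- Strict alternation is impossible: `m + 1` is even.
  obtain ⟨k, hk, hks⟩ : ∃ k, N ≤ k ∧ (0 ≤ d (k + 1) ↔ 0 ≤ d k) := by
    by_contra! halt
    have hstep : ∀ j, (0 ≤ d (N + 2 * j) ↔ 0 ≤ d N) := by
      intro j
      induction j with
      | zero => simp
      | succ j ih =>
        have h1 := halt (N + 2 * j) (by omega)
        have h2 := halt (N + 2 * j + 1) (by omega)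
        rw [show N + 2 * (j + 1) = N + 2 * j + 1 + 1 by ring]
        grind
    obtain ⟨l, rfl⟩ := hm
    have h1 := hstep (l + 1)
    have h2 := anti N le_rfl
    rw [show N + 2 * (l + 1) = N + (2 * l + 1) + 1 by ring] at h1
    tauto
  have adj : ∀ j, (0 ≤ d (k + j * (m + 1) + 1) ↔ 0 ≤ d (k + j * (m + 1))) := by
    intro j
    induction j with
    | zero => simpa using hks
    | succ j ih =>
      have h1 := anti (k + j * (m + 1)) (by nlinarith)
      have h2 := anti (k + j * (m + 1) + 1) (by nlinarith)
      rw [show k + (j + 1) * (m + 1) = k + j * (m + 1) + m + 1 by ring,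
        show k + j * (m + 1) + m + 1 + 1 = k + j * (m + 1) + 1 + m + 1 by ring, h1, h2, ih]
  -- Here `d (n+m)` has the sign opposite to `d n`, so `2 * d (n+m) - d n` is at least as large as
  -- `d n` in absolute value.
  have hmono : Monotone fun j => |d (k + j * (m + 1) + 1)| := by
    refine monotone_nat_of_le_succ fun j => ?_
    have h1 := adj (j + 1)
    have h2 := anti (k + j * (m + 1) + 1) (by nlinarith)
    have h3 := hrec (k + j * (m + 1) + 1)
    rw [show k + (j + 1) * (m + 1) = k + j * (m + 1) + 1 + m by ring] at h1 ⊢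
    rw [h2] at h1
    by_cases ha : 0 ≤ d (k + j * (m + 1) + 1)
    · have hb := mt h1.2 (not_not.2 ha)
      have hc := mt h2.1 (not_not.2 ha)
      push Not at hb hc
      rw [abs_of_nonneg ha, abs_of_neg hc]
      linarith
    · have hb := h1.1 ha
      have hc := h2.2 ha
      push Not at ha
      rw [abs_of_neg ha, abs_of_nonneg hc]
      linarith
  have hlim : Tendsto (fun j => |d (k + j * (m + 1) + 1)|) atTop (𝓝 0) := by
    have hidx : Tendsto (fun j => k + j * (m + 1) + 1) atTop atTop :=
      tendsto_atTop_mono (fun j => by simp only [id]; nlinarith) tendsto_id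
    simpa using (hd.comp hidx).abs
  have hzero : ∀ j, d (k + j * (m + 1) + 1) = 0 := fun j =>
    abs_nonpos_iff.1 (hmono.ge_of_tendsto hlim j)
  have h0 := hzero 0
  have h1 := hzero 1
  have h2 := anti (k + 1) (by omega)
  rw [show k + 1 * (m + 1) + 1 = k + 1 + m + 1 by ring] at h1
  simp at h0
  rw [h0, h1] at h2
  simp at h2

open Polynomial in
-- Newton's identities, by strong induction on the exponent.
theorem Multiset.exists_int_sum_pow_of_esymm (s : Multiset ℂ)
    (hs : ∀ k, ∃ z : ℤ, s.esymm k = z) (n : ℕ) : ∃ z : ℤ, (s.map (· ^ n)).sum = z := by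
  classical
  have hp : ∀ k, MvPolynomial.aeval (fun x : s.ToType => (x.1 : ℂ))
      (MvPolynomial.psum s.ToType ℤ k) = (s.map (· ^ k)).sum := by
    intro k
    simp only [MvPolynomial.psum, map_sum, map_pow, MvPolynomial.aeval_X]
    rw [Finset.sum, ← Multiset.map_univ (f := fun x : ℂ => x ^ k)]
  have he : ∀ k, MvPolynomial.aeval (fun x : s.ToType => (x.1 : ℂ))
      (MvPolynomial.esymm s.ToType ℤ k) ∈ (Int.castRingHom ℂ).range := by
    intro k
    obtain ⟨z, hz⟩ := hs k
    rw [MvPolynomial.aeval_esymm_eq_multiset_esymm, Multiset.map_univ_coe, hz]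
    exact ⟨z, rfl⟩
  suffices h : MvPolynomial.aeval (fun x : s.ToType => (x.1 : ℂ))
      (MvPolynomial.psum s.ToType ℤ n) ∈ (Int.castRingHom ℂ).range by
    obtain ⟨z, hz⟩ := h
    exact ⟨z, by rw [← hp, ← hz]; rfl⟩
  induction n using Nat.strong_induction_on with
  | _ n ih =>
    rcases Nat.eq_zero_or_pos n with rfl | hn
    · exact ⟨Fintype.card s.ToType, by simp⟩
    rw [MvPolynomial.psum_eq_mul_esymm_sub_sum s.ToType ℤ n hn]
    simp only [map_sub, map_mul, map_pow, map_neg, map_one, map_natCast, map_sum]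
    refine sub_mem (mul_mem (mul_mem (pow_mem (neg_mem (one_mem _)) _) (natCast_mem _ _)) (he _))
      (sum_mem fun a ha => ?_)
    rw [Finset.mem_filter, Finset.HasAntidiagonal.mem_antidiagonal, Set.mem_Ioo] at ha
    exact mul_mem (mul_mem (pow_mem (neg_mem (one_mem _)) _) (he _)) (ih _ (by omega))

open Polynomial in
theorem Polynomial.Monic.exists_int_sum_pow_roots {p : ℤ[X]} (hp : p.Monic) (n : ℕ) :
    ∃ z : ℤ, ((p.aroots ℂ).map (· ^ n)).sum = z := by
  refine Multiset.exists_int_sum_pow_of_esymm _ (fun k => ?_) n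
  have hq : (p.map (algebraMap ℤ ℂ)).Monic := hp.map _
  have hcard := (IsAlgClosed.splits (p.map (algebraMap ℤ ℂ))).natDegree_eq_card_roots
  rcases le_or_gt k (p.map (algebraMap ℤ ℂ)).natDegree with hk | hk
  · have h := coeff_eq_esymm_roots_of_card hcard.symm (Nat.sub_le _ k)
    rw [hq.leadingCoeff, Nat.sub_sub_self hk, one_mul, coeff_map] at h
    refine ⟨(-1) ^ k * p.coeff ((p.map (algebraMap ℤ ℂ)).natDegree - k), ?_⟩
    have h1 : ((-1 : ℂ) ^ k) * (-1) ^ k = 1 := by rw [← mul_pow]; simp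
    simp only [algebraMap_int_eq, eq_intCast] at h
    push_cast
    rw [aroots_def, algebraMap_int_eq, h, ← mul_assoc, h1, one_mul]
  · refine ⟨0, ?_⟩
    rw [hcard] at hk
    rw [aroots_def, Multiset.esymm, Multiset.powersetCard_eq_empty _ hk]
    simp

theorem Multiset.tendsto_sum_pow_of_norm_lt_one (t : Multiset ℂ) (ht : ∀ β ∈ t, ‖β‖ < 1) :
    Tendsto (fun n : ℕ => (t.map (· ^ n)).sum) atTop (𝓝 0) := by
  induction t using Multiset.induction with
  | empty => simp
  | cons a t ih =>
    simp only [Multiset.map_cons, Multiset.sum_cons]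
    simpa using (tendsto_pow_atTop_nhds_zero_of_norm_lt_one (ht a (by simp))).add
      (ih fun β hβ => ht β (by simp [hβ]))

theorem eq_of_pow_eq_geom_sum {m : ℕ} {a b : ℝ} (hm : 0 < m) (ha : 0 < a) (hb : 0 < b)
    (hpa : a ^ m = ∑ j ∈ Finset.range m, a ^ j) (hpb : b ^ m = ∑ j ∈ Finset.range m, b ^ j) :
    a = b := by
  wlog hab : a < b generalizing a b
  · rcases lt_trichotomy a b with h | h | h
    · exact this ha hb hpa hpb h
    · exact h
    · exact (this hb ha hpb hpa h).symm
  exfalso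
  have h : ∑ j ∈ Finset.range m, a ^ m * b ^ j < ∑ j ∈ Finset.range m, b ^ m * a ^ j := by
    refine Finset.sum_lt_sum_of_nonempty (by simpa using hm.ne') fun j hj => ?_
    have hj := Finset.mem_range.1 hj
    obtain ⟨i, rfl⟩ := Nat.exists_eq_add_of_lt hj
    have : a ^ (i + 1) < b ^ (i + 1) := pow_lt_pow_left₀ hab ha.le (by simp)
    have hpos : 0 < a ^ j * b ^ j := by positivity
    calc a ^ (j + i + 1) * b ^ j = a ^ j * b ^ j * a ^ (i + 1) := by ring
      _ < a ^ j * b ^ j * b ^ (i + 1) := by gcongr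
      _ = b ^ (j + i + 1) * a ^ j := by ring
  rw [← Finset.mul_sum, ← Finset.mul_sum, ← hpa, ← hpb, mul_comm] at h
  exact lt_irrefl _ h

theorem pow_succ_add_one_of_pow_eq_geom_sum {R : Type*} [CommRing R] {m : ℕ} {x : R}
    (h : x ^ m = ∑ j ∈ Finset.range m, x ^ j) : x ^ (m + 1) + 1 = 2 * x ^ m := by
  have h1 := geom_sum_mul x m
  rw [← h] at h1
  linear_combination h1

/-- If `‖β‖ ≥ 1`, the triangle inequality for `β^(m+1) + 1 = 2 * β^m` is an equality. Then `β^(m+1)`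
and `β^m` are positive, hence so is `β`, and the positive root is unique. -/
theorem norm_lt_one_of_pow_eq_geom_sum {m : ℕ} {r : ℝ} {β : ℂ} (hm : 0 < m) (hr : 0 < r)
    (hpr : r ^ m = ∑ j ∈ Finset.range m, r ^ j) (hβ : β ^ m = ∑ j ∈ Finset.range m, β ^ j)
    (hne : β ≠ r) : ‖β‖ < 1 := by
  by_contra! hge
  apply hne
  have h1 : ‖β‖ ^ m ≤ ∑ j ∈ Finset.range m, ‖β‖ ^ j := by
    rw [← norm_pow, hβ]
    exact (norm_sum_le _ _).trans_eq (by simp)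
  have h2 : ‖β‖ ^ (m + 1) + 1 ≤ 2 * ‖β‖ ^ m := by
    have := mul_le_mul_of_nonneg_right h1 (sub_nonneg.2 hge)
    rw [geom_sum_mul] at this
    rw [pow_succ]
    linarith
  have hP := pow_succ_add_one_of_pow_eq_geom_sum hβ
  have h3 : ‖β ^ (m + 1) + 1‖ = 2 * ‖β‖ ^ m := by rw [hP]; simp
  have h4 : ‖β ^ (m + 1)‖ + 1 ≤ ‖β ^ (m + 1) + 1‖ := by rw [h3, norm_pow]; exact h2
  have h5 : 0 ≤ β ^ (m + 1) := by
    generalize β ^ (m + 1) = z at h4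
    rw [← Complex.re_eq_norm]
    refine le_antisymm (Complex.re_le_norm z) ?_
    have ha := Complex.sq_norm (z + 1)
    have hb := Complex.sq_norm z
    rw [Complex.normSq_apply] at ha hb
    simp at ha
    nlinarith [norm_nonneg z, norm_nonneg (z + 1)]
  have h6 : β ^ (m + 1) = ((‖β‖ ^ (m + 1) : ℝ) : ℂ) := by
    rw [← norm_pow]
    exact Complex.eq_coe_norm_of_nonneg h5
  have h7 : ‖β‖ ^ (m + 1) + 1 = 2 * ‖β‖ ^ m := by
    refine le_antisymm h2 ?_
    rw [← h3]
    exact (norm_add_le _ _).trans_eq (by simp)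
  have h8 : β ^ m = (‖β‖ : ℂ) ^ m := by
    have : ((‖β‖ : ℂ)) ^ (m + 1) + 1 = 2 * (‖β‖ : ℂ) ^ m := by exact_mod_cast h7
    push_cast at h6
    rw [h6] at hP
    linear_combination (this - hP) / 2
  have h9 : β = ‖β‖ := by
    have h0 : (‖β‖ : ℂ) ^ m ≠ 0 := pow_ne_zero _ (by
      have : ‖β‖ ≠ 0 := by linarith
      exact_mod_cast this)
    push_cast at h6
    rw [pow_succ, pow_succ, h8] at h6
    exact mul_left_cancel₀ h0 h6
  rw [h9] at hβ
  have h10 : ‖β‖ = r := eq_of_pow_eq_geom_sum hm (by linarith) hr (by exact_mod_cast hβ) hpr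
  rw [h9, h10]

open Polynomial in
theorem exists_int_seq_tendsto_pow_sub {m : ℕ} {r : ℝ} (hm : 0 < m) (hr : 0 < r)
    (hpr : r ^ m = ∑ j ∈ Finset.range m, r ^ j) :
    ∃ T : ℕ → ℤ, (∀ n, T (n + m + 1) + T n = 2 * T (n + m)) ∧
      Tendsto (fun n => r ^ n - T n) atTop (𝓝 0) := by
  classical
  set p : ℤ[X] := X ^ m - ∑ j ∈ Finset.range m, X ^ j with hpdef
  have hmonic : p.Monic := by
    refine monic_X_pow_sub ?_
    rw [← mem_degreeLT]
    refine sum_mem fun j hj => mem_degreeLT.2 ?_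
    rw [degree_X_pow]
    exact_mod_cast Finset.mem_range.1 hj
  have hroot : ∀ β : ℂ, β ∈ p.aroots ℂ ↔ β ^ m = ∑ j ∈ Finset.range m, β ^ j := by
    intro β
    rw [mem_aroots, and_iff_right hmonic.ne_zero]
    simp [hpdef, sub_eq_zero]
  have hrmem : (r : ℂ) ∈ p.aroots ℂ := by
    rw [hroot]
    exact_mod_cast hpr
  -- At a double root, `r * p'(r) = 0` and `p(r) = 0` would give `∑ (m - j) * r^j = 0`, a sum of
  -- positive terms.
  have hcount : (p.aroots ℂ).count (r : ℂ) ≤ 1 := by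
    by_contra! h
    rw [aroots_def, count_roots,
      one_lt_rootMultiplicity_iff_isRoot (hmonic.map _).ne_zero] at h
    have h1 := h.2
    rw [IsRoot, derivative_map, eval_map_algebraMap, hpdef] at h1
    simp only [derivative_X_pow, map_sub, map_sum, map_mul, map_pow, aeval_X, map_natCast] at h1
    have h2 : (m : ℝ) * r ^ (m - 1) - ∑ j ∈ Finset.range m, (j : ℝ) * r ^ (j - 1) = 0 := by
      exact_mod_cast h1
    have h3 : ∀ j : ℕ, (j : ℝ) * r ^ (j - 1) * r = j * r ^ j := by
      intro j
      cases j with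
      | zero => simp
      | succ j => simp; ring
    have h4 : ∑ j ∈ Finset.range m, ((m : ℝ) - j) * r ^ j = 0 := by
      have := congrArg (· * r) h2
      simp only [sub_mul, Finset.sum_mul, h3, zero_mul] at this
      rw [hpr, Finset.mul_sum] at this
      simpa only [sub_mul, Finset.sum_sub_distrib] using this
    refine (Finset.sum_pos (fun j hj => ?_) (by simpa using hm.ne')).ne' h4
    have : (j : ℝ) < m := by exact_mod_cast Finset.mem_range.1 hj
    have := sub_pos.2 this
    positivity
  choose T hT using hmonic.exists_int_sum_pow_roots
  refine ⟨T, fun n => ?_, ?_⟩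
  · have h : ((T (n + m + 1) + T n : ℤ) : ℂ) = (2 * T (n + m) : ℤ) := by
      push_cast
      rw [← hT, ← hT, ← hT, ← Multiset.sum_map_add, ← Multiset.sum_map_mul_left]
      refine congrArg _ (Multiset.map_congr rfl fun β hβ => ?_)
      linear_combination β ^ n * pow_succ_add_one_of_pow_eq_geom_sum ((hroot β).1 hβ)
    exact_mod_cast h
  · have ht : ∀ β ∈ (p.aroots ℂ).erase (r : ℂ), ‖β‖ < 1 := by
      intro β hβ
      refine norm_lt_one_of_pow_eq_geom_sum hm hr hpr ((hroot β).1 (Multiset.mem_of_mem_erase hβ)) ?_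
      rintro rfl
      have := Multiset.count_pos.2 hβ
      rw [Multiset.count_erase_self] at this
      omega
    have hlim := (Multiset.tendsto_sum_pow_of_norm_lt_one _ ht).neg
    rw [neg_zero] at hlim
    have heq : ∀ n, -(((p.aroots ℂ).erase (r : ℂ)).map (· ^ n)).sum
        = ((r ^ n - T n : ℝ) : ℂ) := by
      intro n
      have := hT n
      rw [← Multiset.cons_erase hrmem, Multiset.map_cons, Multiset.sum_cons] at this
      push_cast
      linear_combination -this
    simp only [heq] at hlim
    simpa only [Function.comp_def, Complex.ofReal_re, Complex.zero_re] using
      (Complex.continuous_re.tendsto 0).comp hlim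

theorem exists_pow_eq_geom_sum_near_two {a : ℝ} (ha : 1 < a) (ha2 : a < 2) :
    ∃ m : ℕ, Odd m ∧ ∃ r, a < r ∧ r < 2 ∧ r ^ m = ∑ j ∈ Finset.range m, r ^ j := by
  obtain ⟨k, hk⟩ := pow_unbounded_of_one_lt (1 / (2 - a)) ha
  have hk' : 1 / (2 - a) < a ^ (2 * k + 1) :=
    hk.trans_le (pow_le_pow_right₀ ha.le (by omega))
  rw [div_lt_iff₀ (by linarith)] at hk'
  -- Multiplied by `x - 1`, the equation becomes `x^m * (2 - x) = 1`.
  have hcont : ContinuousOn (fun x : ℝ => x ^ (2 * k + 1) * (2 - x)) (Set.Icc a 2) := by fun_prop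
  obtain ⟨r, ⟨h1, h2⟩, hr⟩ := intermediate_value_Ioo' ha2.le hcont
    (show (1 : ℝ) ∈ Set.Ioo _ _ from ⟨by simp, hk'⟩)
  refine ⟨2 * k + 1, ⟨k, rfl⟩, r, h1, h2, ?_⟩
  refine mul_right_cancel₀ (show r - 1 ≠ 0 by linarith) ?_
  rw [geom_sum_mul]
  simp only at hr
  linear_combination -hr

theorem floor_eq_of_abs_sub_lt_one {x : ℝ} {z : ℤ} (h : |x - z| < 1) :
    ⌊x⌋ = if 0 ≤ x - z then z else z - 1 := by
  rw [abs_lt] at h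
  rw [Int.floor_eq_iff]
  split_ifs with h0 <;> push_cast <;> constructor <;> linarith

theorem theorem3 :
    ∀ ε : ℝ, 0 < ε → ∃ r : ℝ, r ∈ Set.Ioo (2 - ε) 2 ∧ ¬ IsTailSidon r := by
  intro ε hε
  obtain ⟨m, hm, r, hra, hr2, hpr⟩ := exists_pow_eq_geom_sum_near_two
    (a := max (2 - ε) (3 / 2)) (lt_max_of_lt_right (by norm_num)) (max_lt (by linarith) (by norm_num))
  rw [max_lt_iff] at hra
  obtain ⟨hrε, hr⟩ := hra
  refine ⟨r, ⟨hrε, hr2⟩, ?_⟩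
  rintro ⟨N₀, hS⟩
  obtain ⟨T, hT, hlim⟩ := exists_int_seq_tendsto_pow_sub hm.pos (by linarith) hpr
  have hrec : ∀ n, (r ^ (n + m + 1) - T (n + m + 1)) + (r ^ n - T n)
      = 2 * (r ^ (n + m) - T (n + m)) := by
    intro n
    have h : (T (n + m + 1) : ℝ) + T n = 2 * T (n + m) := by exact_mod_cast hT n
    linear_combination r ^ n * pow_succ_add_one_of_pow_eq_geom_sum hpr - h
  obtain ⟨N₁, hN₁⟩ := eventually_atTop.1
    ((by simpa using hlim.abs : Tendsto (fun n => |r ^ n - T n|) atTop (𝓝 0)).eventually_lt_const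
      one_pos)
  obtain ⟨n, hn, hs₁, hs₂⟩ :=
    exists_same_sign_of_recurrence hm hlim hrec (max (max N₀ N₁) 2)
  simp only [max_le_iff] at hn
  obtain ⟨⟨hn₀, hn₁⟩, hn₂⟩ := hn
  have hsum : ⌊r ^ (n + m + 1)⌋ + ⌊r ^ n⌋ = ⌊r ^ (n + m)⌋ + ⌊r ^ (n + m)⌋ := by
    rw [floor_eq_of_abs_sub_lt_one (hN₁ n hn₁), floor_eq_of_abs_sub_lt_one (hN₁ (n + m) (by omega)),
      floor_eq_of_abs_sub_lt_one (hN₁ (n + m + 1) (by omega))]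
    simp only [← hs₁, ← hs₂]
    have := hT n
    split_ifs <;> omega
  have hlt : ⌊r ^ (n + m)⌋ < ⌊r ^ (n + m + 1)⌋ := by
    rw [← Int.add_one_le_iff, Int.le_floor]
    push_cast
    -- The gap between the two powers is at least `(1/2) * (9/4) > 1`.
    have h1 : (3 / 2 : ℝ) ^ 2 ≤ r ^ (n + m) :=
      (pow_le_pow_left₀ (by norm_num) hr.le 2).trans
        (pow_le_pow_right₀ (by linarith) (by omega))
    have h2 := Int.floor_le (r ^ (n + m))
    rw [pow_succ]
    nlinarith
  rcases hS _ ⟨n + m + 1, by omega, rfl⟩ _ ⟨n, hn₀, rfl⟩ _ ⟨n + m, by omega, rfl⟩ _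
    ⟨n + m, by omega, rfl⟩ hsum with h | h
  · exact hlt.ne' h.1
  · exact hlt.ne' h.1
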